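/- Let $H$ be a positive definite Hermitian $n\times n$ matrix, let $\rho_H(z)=\overline z^{T}Hz$ for $z\in\mathbb{C}^n$, and let $D=D_H=\{z\in\mathbb{C}^n:\rho_H(z)<1\}$. Let $\operatorname{PSH}(D)^-$ be the family of non-positive plurisubharmonic functions $u:D\to[-\infty,0]$. For $\zeta\in\partial D$ put $$u^*(\zeta)=\limsup_{z\to\zeta,\ z\in D}u(z),\qquad u^n(\zeta)=\limsup_{t\downarrow 0}u\bigl(n(\zeta,t)\bigr),\qquad u^R(\zeta)=\limsup_{r\uparrow 1}u(r\zeta),$$ where $n(\zeta,t)=\zeta-t\left(\frac{\partial\rho}{\partial\overline z_1}(\zeta),\dots,\frac{\partial\rho}{\partial\overline z_n}(\zeta)\right)$ with $\rho=\rho_H-1$; for $t>0$ this parametrizes the inward normal to $\partial D$ at $\zeta$. For a compact set $A\subset\partial D$ and $z\in D$ define the boundary relative extremal functions \begin{align*} \omega^c(z,A,D)&=\sup\{u(z): u\in\operatorname{PSH}(D)^-\cap C(\overline D),\ u\le-1\text{ on }A\},\\ \omega(z,A,D)&=\sup\{u(z): u\in\operatorname{PSH}(D)^-,\ u^*\le-1\text{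 on }A\},\\ \omega^n(z,A,D)&=\sup\{u(z): u\in\operatorname{PSH}(D)^-,\ u^n\le-1\text{ on }A\},\\ \omega^R(z,A,D)&=\sup\{u(z): u\in\operatorname{PSH}(D)^-,\ u^R\le-1\text{ on }A\}. \end{align*} Then for every compact $A\subset\partial D_H$ and every $z\in D_H$, $$\omega(z,A,D_H)=\omega^n(z,A,D_H)=\omega^R(z,A,D_H)=\omega^c(z,A,D_H).$$ -/

import Mathlib

open Filter Topology MeasureTheory
open scoped ComplexOrder

namespace BoundaryExtremal

noncomputable section

/-- The integral `∫ f⁺ - ∫ f⁻` over `[0,1]` of an extended real valued function. It is used only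
for functions that are bounded above, so that the first term is finite; its value may be `-∞`. -/
def unitIntegral (f : ℝ → EReal) : EReal :=
  ((∫⁻ t in Set.Icc (0 : ℝ) 1, (f t).toENNReal : ENNReal) : EReal) -
    ((∫⁻ t in Set.Icc (0 : ℝ) 1, (-f t).toENNReal : ENNReal) : EReal)

/-- `u` (of which only the values on the open set `D` matter) is plurisubharmonic on `D`: it takes
values in `ℝ ∪ {-∞}`, it is upper semicontinuous on `D`, and it satisfies the sub-mean value
inequality on every closed disc `{a + ζ b : |ζ| ≤ 1}` contained in `D`. The constant `-∞` is
allowed. -/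
structure IsPSH {n : ℕ} (D : Set (Fin n → ℂ)) (u : (Fin n → ℂ) → EReal) : Prop where
  lt_top : ∀ z ∈ D, u z < ⊤
  usc : UpperSemicontinuousOn u D
  sub_mean : ∀ a b : Fin n → ℂ, (∀ ζ : ℂ, ‖ζ‖ ≤ 1 → a + ζ • b ∈ D) →
    u a ≤ unitIntegral fun t => u (a + Complex.exp (2 * Real.pi * t * Complex.I) • b)

/-- The class of non-positive plurisubharmonic functions on `D`. -/
def PSHNeg {n : ℕ} (D : Set (Fin n → ℂ)) : Set ((Fin n → ℂ) → EReal) :=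
  {u | IsPSH D u ∧ ∀ z ∈ D, u z ≤ 0}

/-- The boundary value `u^*(ζ)`: the upper limit of `u` at `ζ` from within `D`. -/
def upperLimit {n : ℕ} (D : Set (Fin n → ℂ)) (u : (Fin n → ℂ) → EReal) (ζ : Fin n → ℂ) : EReal :=
  limsup u (𝓝[D] ζ)

/-- The vector `(∂ρ/∂z̄₁, …, ∂ρ/∂z̄ₙ)` at `z`, with `∂/∂z̄ⱼ = (∂/∂xⱼ + i ∂/∂yⱼ) / 2`. -/
def dbarGrad {n : ℕ} (ρ : (Fin n → ℂ) → ℝ) (z : Fin n → ℂ) : Fin n → ℂ := fun j =>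
  (1 / 2 : ℂ) * ((fderiv ℝ ρ z (Pi.single j 1) : ℂ) +
    Complex.I * (fderiv ℝ ρ z (Pi.single j Complex.I) : ℂ))

/-- The parametrization `n(z,t) = z - t ∂ρ/∂z̄(z)` of the normal line at `z`; at a boundary point of
`{ρ < 0}` the inward normal corresponds to `t > 0`. -/
def normalPoint {n : ℕ} (ρ : (Fin n → ℂ) → ℝ) (z : Fin n → ℂ) (t : ℝ) : Fin n → ℂ :=
  z - (t : ℂ) • dbarGrad ρ z

/-- The boundary value of `u` at `ζ` along the inward normal. -/
def normalLimit {n : ℕ} (ρ : (Fin n → ℂ) → ℝ) (u : (Fin n → ℂ) → EReal) (ζ : Fin n → ℂ) : EReal :=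
  limsup (fun t : ℝ => u (normalPoint ρ ζ t)) (𝓝[>] 0)

/-- The radial boundary value of `u` at `ζ`. -/
def radialLimit {n : ℕ} (u : (Fin n → ℂ) → EReal) (ζ : Fin n → ℂ) : EReal :=
  limsup (fun r : ℝ => u ((r : ℂ) • ζ)) (𝓝[<] 1)

/-- `ω^c(z, A, D)`: the supremum over the functions that are non-positive and plurisubharmonic on
`D`, real valued and continuous on `closure D`, and at most `-1` on `A`. -/
def omegaC {n : ℕ} (D A : Set (Fin n → ℂ)) (z : Fin n → ℂ) : EReal :=
  sSup {x : EReal | ∃ u : (Fin n → ℂ) → ℝ, (fun w => (u w : EReal)) ∈ PSHNeg D ∧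
    ContinuousOn u (closure D) ∧ (∀ ζ ∈ A, u ζ ≤ -1) ∧ x = (u z : EReal)}

/-- `ω(z, A, D)`: the boundary condition is `u^* ≤ -1` on `A`. -/
def omega {n : ℕ} (D A : Set (Fin n → ℂ)) (z : Fin n → ℂ) : EReal :=
  sSup {x : EReal | ∃ u ∈ PSHNeg D, (∀ ζ ∈ A, upperLimit D u ζ ≤ -1) ∧ x = u z}

/-- `ω^n(z, A, D)`, where `ρ` is a defining function of `D`: the boundary condition is on the upper
limits along the inward normals at the points of `A`. -/
def omegaN {n : ℕ} (D : Set (Fin n → ℂ)) (ρ : (Fin n → ℂ) → ℝ) (A : Set (Fin n → ℂ))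
    (z : Fin n → ℂ) : EReal :=
  sSup {x : EReal | ∃ u ∈ PSHNeg D, (∀ ζ ∈ A, normalLimit ρ u ζ ≤ -1) ∧ x = u z}

/-- `ω^R(z, A, D)`, for `D` strongly star shaped with respect to `0`: the boundary condition is on
the radial upper limits at the points of `A`. -/
def omegaR {n : ℕ} (D A : Set (Fin n → ℂ)) (z : Fin n → ℂ) : EReal :=
  sSup {x : EReal | ∃ u ∈ PSHNeg D, (∀ ζ ∈ A, radialLimit u ζ ≤ -1) ∧ x = u z}

/-- `ρ_H(z) = z̄ᵀ H z` (a real number for Hermitian `H`). -/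
def hermForm {n : ℕ} (H : Matrix (Fin n) (Fin n) ℂ) (z : Fin n → ℂ) : ℝ :=
  (star z ⬝ᵥ H.mulVec z).re

/-- The ellipsoid `D_H = {ρ_H < 1}`. -/
def ellipsoid {n : ℕ} (H : Matrix (Fin n) (Fin n) ℂ) : Set (Fin n → ℂ) :=
  {z | hermForm H z < 1}

end

end BoundaryExtremal

/-! The inequalities `omegaC ≤ omega ≤ omegaN` and `omega ≤ omegaR` only compare boundary
conditions. The content is that a function `u` with upper limit at most `-1` merely along the
normals (or radii) at `A` is still dominated by `omegaC`.

Both families of paths have the form `ζ - t M ζ` with a single complex linear `M`: the matrix `H`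
for normals, the identity for radii. For small `t > 0` the map `T = id - t M` sends the closure of
`D` into `D`, so composition with `T` preserves the sub-mean value inequality. With `v = max u
(-1)`, the functions `v ∘ T` tend to `-1` on `A`, pointwise and boundedly, as `t → 0`. Three
difficulties remain.

Continuity: a sup-convolution of `v`, composed with `T`, is continuous and keeps the sub-mean value
inequality, because `T` leaves a positive margin inside `D` (`subMeanOn_supConvolution_comp`).

Uniformity on `A`: candidates form a convex set. If none were below `-1 + ε` on all of `A`,
Hahn-Banach and Riesz would give a measure contradicting dominated convergence
(`exists_candidate_lt`).

The value at `z`: upper semicontinuity does not prevent `v (T z)` from staying far below `v z`. A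
real segment is not thin at its end point, however, so `v (T z) > v z - ε` for arbitrarily small `t`
(`frequently_lt_along_segment`).

Dividing the resulting candidate by `1 - ε` and letting `ε → 0` finishes the proof. -/

namespace BoundaryExtremal

/-! ### Subharmonic functions of one variable on a slit disc -/

/-- The sub-mean value inequality of a non-positive real function `v` on the closed discs contained
in `S`, written as a super-mean value inequality for `-v`. -/
def SubMeanOn {V : Type*} [AddCommGroup V] [Module ℂ V] (S : Set V) (v : V → ℝ) : Prop :=
  ∀ a b : V, (∀ ζ : ℂ, ‖ζ‖ ≤ 1 → a + ζ • b ∈ S) →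
    ∫⁻ t in Set.Icc (0 : ℝ) 1,
      ENNReal.ofReal (-v (a + Complex.exp (2 * Real.pi * t * Complex.I) • b)) ≤
        ENNReal.ofReal (-v a)

theorem norm_exp_two_pi_mul (t : ℝ) : ‖Complex.exp (2 * Real.pi * t * Complex.I)‖ = 1 := by
  have := Complex.norm_exp_ofReal_mul_I (2 * Real.pi * t)
  push_cast at this
  exact this

theorem integral_unit_circle_eq {F : ℂ → ℂ} {p : ℂ} {r : ℝ} (hr : 0 < r)
    (hF : DiffContOnCl ℂ F (Metric.ball p r)) :
    ∫ t in (0 : ℝ)..1, F (p + Complex.exp (2 * Real.pi * t * Complex.I) * r) = F p := by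
  have h1 := DiffContOnCl.circleAverage (f := F) (c := p) (R := r) (by rwa [abs_of_pos hr])
  rw [Real.circleAverage_def] at h1
  have h2 := intervalIntegral.integral_comp_mul_left (a := 0) (b := 1)
    (fun θ => F (circleMap p r θ)) (c := 2 * Real.pi) (by positivity)
  simp only [mul_zero, mul_one] at h2
  rw [h1] at h2
  rw [← h2]
  congr 1
  ext t
  rw [circleMap]
  push_cast
  congr 2
  ring

/-- The mean of `-Re F` over the circle is `-Re F(p)`. It is at most the mean of its positive part,
so the truncation by `ENNReal.ofReal` acts in the favourable direction and `Re F` needs no sign. -/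
theorem le_re_of_le_re_on_sphere {v : ℂ → ℝ} {F : ℂ → ℂ} {p : ℂ} {r : ℝ} (hr : 0 < r)
    (hv : v p ≤ 0)
    (hm : ∫⁻ t in Set.Icc (0 : ℝ) 1,
      ENNReal.ofReal (-v (p + Complex.exp (2 * Real.pi * t * Complex.I) • (r : ℂ))) ≤
        ENNReal.ofReal (-v p))
    (hF : DiffContOnCl ℂ F (Metric.ball p r))
    (h : ∀ z ∈ Metric.sphere p r, v z ≤ (F z).re) : v p ≤ (F p).re := by
  set γ : ℝ → ℂ := fun t => p + Complex.exp (2 * Real.pi * t * Complex.I) * r with hγ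
  have hγs : ∀ t, γ t ∈ Metric.sphere p r := by
    intro t
    simp [hγ, norm_exp_two_pi_mul, abs_of_pos hr]
  have hcont : Continuous fun t => F (γ t) := by
    refine hF.continuousOn.comp_continuous (by fun_prop) fun t => ?_
    rw [closure_ball p hr.ne']
    exact Metric.sphere_subset_closedBall (hγs t)
  have hre : Continuous fun t => -(F (γ t)).re := (Complex.continuous_re.comp hcont).neg
  have hint : ∫ t in Set.Icc (0 : ℝ) 1, -(F (γ t)).re = -(F p).re := by
    have h1 := integral_unit_circle_eq hr hF
    rw [integral_Icc_eq_integral_Ioc, ← intervalIntegral.integral_of_le zero_le_one,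
      intervalIntegral.integral_neg]
    have h2 := Complex.reCLM.intervalIntegral_comp_comm
      (hcont.intervalIntegrable (μ := volume) 0 1)
    simp only [Complex.reCLM_apply] at h2
    rw [h2, h1]
  have hle : ENNReal.ofReal (-(F p).re) ≤ ENNReal.ofReal (-v p) := by
    refine le_trans ?_ hm
    have hInt : IntegrableOn (fun t => -(F (γ t)).re) (Set.Icc 0 1) := hre.integrableOn_Icc
    have h3 : -(F p).re ≤
        (∫⁻ t in Set.Icc (0 : ℝ) 1, ENNReal.ofReal (-(F (γ t)).re)).toReal := by
      rw [← hint, integral_eq_lintegral_pos_part_sub_lintegral_neg_part hInt]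
      exact sub_le_self _ ENNReal.toReal_nonneg
    refine (ENNReal.ofReal_le_ofReal h3).trans (ENNReal.ofReal_toReal_le.trans ?_)
    refine lintegral_mono fun t => ENNReal.ofReal_le_ofReal ?_
    exact neg_le_neg (h _ (hγs t))
  rw [ENNReal.ofReal_le_ofReal_iff (by linarith)] at hle
  linarith

/-- `√((|z| + Re z) / 2)`, the real part of the principal square root. -/
theorem re_exp_half_log {z : ℂ} (hz : z ≠ 0) :
    (Complex.exp (Complex.log z / 2)).re = √((‖z‖ + z.re) / 2) := by
  set w := Complex.exp (Complex.log z / 2) with hw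
  have hsq : w ^ 2 = z := by
    rw [hw, ← Complex.exp_nat_mul]
    push_cast
    rw [mul_div_cancel₀ _ two_ne_zero, Complex.exp_log hz]
  have hn : ‖z‖ = w.re ^ 2 + w.im ^ 2 := by
    rw [← hsq, norm_pow, Complex.sq_norm, Complex.normSq_apply]; ring
  have hr : z.re = w.re ^ 2 - w.im ^ 2 := by
    rw [← hsq, sq, Complex.mul_re]; ring
  have hpos : 0 ≤ w.re := by
    rw [hw, Complex.exp_re]
    refine mul_nonneg (Real.exp_pos _).le (Real.cos_nonneg_of_mem_Icc ?_)
    have h1 := Complex.neg_pi_lt_arg z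
    have h2 := Complex.arg_le_pi z
    have : (Complex.log z / 2).im = z.arg / 2 := by
      rw [show Complex.log z / 2 = Complex.log z / ((2 : ℝ) : ℂ) by simp, Complex.div_ofReal_im,
        Complex.log_im]
    rw [this]
    constructor <;> linarith
  rw [hn, hr]
  ring_nf
  rw [Real.sqrt_sq hpos]

/-- On a circle `‖z‖ ^ 2` is the real part of an affine holomorphic function, whose value at the
center exceeds `‖p‖ ^ 2` by `r ^ 2`. This gain makes the maximum principle below strict. -/
theorem normSq_add_of_mem_sphere {p z : ℂ} {r : ℝ} (hz : z ∈ Metric.sphere p r) :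
    ‖z‖ ^ 2 = ‖p‖ ^ 2 + r ^ 2 + 2 * ((starRingEnd ℂ) p * (z - p)).re := by
  have h : ‖z - p‖ ^ 2 = r ^ 2 := by rw [← dist_eq_norm, Metric.mem_sphere.1 hz]
  rw [← h]
  simp only [Complex.sq_norm, Complex.normSq_apply, Complex.mul_re, Complex.sub_re, Complex.sub_im,
    Complex.conj_re, Complex.conj_im]
  ring

/-- The maximum principle on an annulus slit along the negative real axis. -/
theorem le_of_le_on_slit_boundary {f : ℂ → ℝ} {R c ε K η κ : ℝ} (hR : 0 < R)
    (husc : UpperSemicontinuousOn f (Metric.closedBall 0 R))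
    (hf0 : ∀ z ∈ Metric.closedBall (0 : ℂ) R, f z ≤ 0) (hc : -1 ≤ c)
    (hm : SubMeanOn (Metric.closedBall 0 R) f)
    (hs : ∀ s ∈ Set.Ioc 0 R, f (-(s : ℂ)) ≤ c)
    (hε : 0 < ε) (hK : 0 ≤ K) (hη : 0 < η) (hκ : 0 < κ)
    (hbd : ∀ z : ℂ, ‖z‖ = R → f z ≤ c + ε + K * √((‖z‖ + z.re) / 2))
    {z : ℂ} (hz0 : z ≠ 0) (hzR : ‖z‖ ≤ R) :
    f z ≤ c + ε + K * √((‖z‖ + z.re) / 2) - η * (Real.log ‖z‖ - Real.log R)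
      + κ * (R ^ 2 - ‖z‖ ^ 2) := by
  set h : ℂ → ℝ := fun z => c + ε + K * √((‖z‖ + z.re) / 2) - η * (Real.log ‖z‖ - Real.log R)
      + κ * (R ^ 2 - ‖z‖ ^ 2) with hh
  change f z ≤ h z
  -- Within radius `R * exp (-1/η)` the logarithmic term is at least `1`, so `h > 0 ≥ f` there,
  -- using `-1 ≤ c`. This keeps a maximum point with `f > h` off the inner circle.
  set ρ := min ‖z‖ (R * Real.exp (-(1 / η))) with hρ
  have hρ0 : 0 < ρ := lt_min (norm_pos_iff.2 hz0) (by positivity)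
  set S : Set ℂ := Metric.closedBall 0 R ∩ {w | ρ ≤ ‖w‖} with hS
  have hScomp : IsCompact S :=
    (isCompact_closedBall _ _).inter_right (isClosed_le continuous_const continuous_norm)
  have hcont : ContinuousOn h S := by
    have hlog : ContinuousOn (fun w : ℂ => Real.log ‖w‖) S :=
      continuous_norm.continuousOn.log fun w hw => (hρ0.trans_le hw.2).ne'
    have hsq : ContinuousOn (fun w : ℂ => √((‖w‖ + w.re) / 2)) S := by
      have : Continuous fun w : ℂ => (‖w‖ + w.re) / 2 := by fun_prop
      exact (Real.continuous_sqrt.comp this).continuousOn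
    have hn : ContinuousOn (fun w : ℂ => ‖w‖ ^ 2) S := by fun_prop
    exact (((continuousOn_const.add (continuousOn_const.mul hsq)).sub
      (continuousOn_const.mul (hlog.sub continuousOn_const))).add
      (continuousOn_const.mul (continuousOn_const.sub hn)))
  have hG : UpperSemicontinuousOn (fun w => f w + -h w) S :=
    (husc.mono Set.inter_subset_left).add hcont.neg.upperSemicontinuousOn
  have hzS : z ∈ S := ⟨by simpa using hzR, (min_le_left _ _ : ρ ≤ ‖z‖)⟩
  obtain ⟨p, hpS, hp⟩ := hG.exists_isMaxOn ⟨z, hzS⟩ hScomp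
  by_contra! hlt
  have hpmax : ∀ w ∈ S, f w - h w ≤ f p - h p := fun w hw => by
    have := hp hw
    simp only [Set.mem_ofPred_eq] at this
    linarith
  have hp_pos : h p < f p := by
    have := hpmax z hzS
    linarith
  have hpR : ‖p‖ ≤ R := by simpa using hpS.1
  have hp0 : 0 < ‖p‖ := hρ0.trans_le hpS.2
  have hsq0 : 0 ≤ K * √((‖p‖ + p.re) / 2) := by positivity
  have hlog0 : Real.log ‖p‖ ≤ Real.log R := Real.log_le_log hp0 hpR
  have hη0 : 0 ≤ η * (Real.log R - Real.log ‖p‖) := mul_nonneg hη.le (sub_nonneg.2 hlog0)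
  have hκ0 : 0 ≤ κ * (R ^ 2 - ‖p‖ ^ 2) :=
    mul_nonneg hκ.le (sub_nonneg.2 (pow_le_pow_left₀ hp0.le hpR 2))
  have hpc : c + ε < f p := by
    refine lt_of_le_of_lt ?_ hp_pos
    simp only [hh]
    linarith
  have hpR' : ‖p‖ < R := by
    refine lt_of_le_of_ne hpR fun he => ?_
    have := hbd p he
    simp only [hh, he] at hp_pos this
    linarith
  have hpslit : p ∈ Complex.slitPlane := by
    by_contra hns
    rw [Complex.mem_slitPlane_iff] at hns
    push Not at hns
    have hpe : p = -((-p.re : ℝ) : ℂ) := Complex.ext (by simp) (by simp [hns.2])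
    have hpre : p.re ≠ 0 := fun h0 => by
      rw [h0] at hpe
      simp [hpe] at hp0
    have habs : |p.re| ≤ ‖p‖ := Complex.abs_re_le_norm p
    have := hs (-p.re) ⟨by have := lt_of_le_of_ne hns.1 hpre; linarith,
      ((neg_le_abs _).trans habs).trans hpR⟩
    rw [← hpe] at this
    linarith
  have hpρ : ρ < ‖p‖ := by
    refine lt_of_le_of_ne hpS.2 fun he => ?_
    have h1 : ‖p‖ ≤ R * Real.exp (-(1 / η)) := he ▸ min_le_right _ _
    have h2 : Real.log ‖p‖ ≤ Real.log R - 1 / η := by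
      have := Real.log_le_log hp0 h1
      rwa [Real.log_mul hR.ne' (Real.exp_pos _).ne', Real.log_exp] at this
    have h3 : 1 ≤ η * (Real.log R - Real.log ‖p‖) := by
      calc (1 : ℝ) = η * (1 / η) := by field_simp
        _ ≤ _ := mul_le_mul_of_nonneg_left (by linarith) hη.le
    have h4 := hf0 p hpS.1
    simp only [hh] at hp_pos
    linarith
  set U : Set ℂ := Complex.slitPlane ∩ (Metric.ball 0 R ∩ {w | ρ < ‖w‖}) with hU
  have hUo : IsOpen U := Complex.isOpen_slitPlane.inter
    (Metric.isOpen_ball.inter (isOpen_lt continuous_const continuous_norm))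
  have hpU : p ∈ U := ⟨hpslit, by simpa using hpR', hpρ⟩
  obtain ⟨r, hr, hrU⟩ := Metric.nhds_basis_closedBall.mem_iff.1 (hUo.mem_nhds hpU)
  have hUS : U ⊆ S := fun w hw => ⟨Metric.ball_subset_closedBall hw.2.1, (le_of_lt hw.2.2 : ρ ≤ ‖w‖)⟩
  -- On the circle of radius `r` about `p`, `Re F = h + (f p - h p) ≥ f`. At the center `Re F = f p
  -- - κ r²`, which contradicts the mean value inequality.
  set F : ℂ → ℂ := fun w => ((c + ε + η * Real.log R + κ * R ^ 2 + (f p - h p) : ℝ) : ℂ)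
    + (K : ℂ) * Complex.exp (Complex.log w / 2) - (η : ℂ) * Complex.log w
    - (κ : ℂ) * (((‖p‖ ^ 2 + r ^ 2 : ℝ) : ℂ) + 2 * ((starRingEnd ℂ) p * (w - p))) with hF
  have hFre : ∀ w ∈ U, (F w).re = c + ε + η * Real.log R + κ * R ^ 2 + (f p - h p)
      + K * √((‖w‖ + w.re) / 2) - η * Real.log ‖w‖
      - κ * (‖p‖ ^ 2 + r ^ 2 + 2 * ((starRingEnd ℂ) p * (w - p)).re) := by
    intro w hw
    have hw0 : w ≠ 0 := Complex.slitPlane_ne_zero hw.1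
    rw [← re_exp_half_log hw0, ← Complex.log_re]
    simp only [hF, Complex.sub_re, Complex.add_re, Complex.re_ofReal_mul, Complex.ofReal_re]
    congr 2
    rw [show (2 : ℂ) = ((2 : ℝ) : ℂ) by simp, Complex.re_ofReal_mul]
  have hFd : DifferentiableOn ℂ F U := by
    intro w hw
    have hlog : DifferentiableAt ℂ Complex.log w := Complex.differentiableAt_log hw.1
    have : DifferentiableAt ℂ F w := by fun_prop
    exact this.differentiableWithinAt
  have hball : closure (Metric.ball p r) ⊆ U := by rwa [closure_ball p hr.ne']
  have hmean : f p ≤ (F p).re := by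
    refine le_re_of_le_re_on_sphere hr (hf0 p hpS.1) (hm p r fun ζ hζ => ?_)
      (hFd.mono hball).diffContOnCl fun w hw => ?_
    · refine (hUS (hrU ?_)).1
      rw [Metric.mem_closedBall, dist_eq_norm, add_sub_cancel_left, smul_eq_mul, norm_mul,
        Complex.norm_real, Real.norm_of_nonneg hr.le]
      exact mul_le_of_le_one_left hr.le hζ
    · have hwU := hrU (Metric.sphere_subset_closedBall hw)
      rw [hFre w hwU, ← normSq_add_of_mem_sphere hw]
      have := hpmax w (hUS hwU)
      have h5 : h w = c + ε + K * √((‖w‖ + w.re) / 2) - η * (Real.log ‖w‖ - Real.log R)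
        + κ * (R ^ 2 - ‖w‖ ^ 2) := rfl
      linarith
  rw [hFre p hpU] at hmean
  have h5 : h p = c + ε + K * √((‖p‖ + p.re) / 2) - η * (Real.log ‖p‖ - Real.log R)
    + κ * (R ^ 2 - ‖p‖ ^ 2) := rfl
  have h6 : 0 < κ * r ^ 2 := by positivity
  simp only [sub_self, mul_zero, Complex.zero_re] at hmean
  linarith

/-- A bounded subharmonic function that is at most `c` on a segment issuing from `0` is at most `c`
at `0`: a segment is not thin at its end points. -/
theorem le_of_le_on_segment {f : ℂ → ℝ} {R c : ℝ} (hR : 0 < R)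
    (husc : UpperSemicontinuousOn f (Metric.closedBall 0 R))
    (hf0 : ∀ z ∈ Metric.closedBall (0 : ℂ) R, f z ≤ 0)
    (hf1 : ∀ z ∈ Metric.closedBall (0 : ℂ) R, -1 ≤ f z)
    (hm : SubMeanOn (Metric.closedBall 0 R) f)
    (hs : ∀ s ∈ Set.Ioc 0 R, f (-(s : ℂ)) ≤ c) : f 0 ≤ c := by
  have hRmem : -(R : ℂ) ∈ Metric.closedBall (0 : ℂ) R := by simp [abs_of_pos hR]
  have hc : -1 ≤ c := (hf1 _ hRmem).trans (hs R ⟨hR, le_rfl⟩)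
  by_contra! hlt
  set ε := (f 0 - c) / 5 with hεdef
  have hε : 0 < ε := by rw [hεdef]; linarith
  obtain ⟨K, hK, hbd⟩ : ∃ K : ℝ, 0 ≤ K ∧
      ∀ z : ℂ, ‖z‖ = R → f z ≤ c + ε + K * √((‖z‖ + z.re) / 2) := by
    -- Near `-R` semicontinuity already gives `f < c + ε`. On the rest of the circle the square root
    -- is bounded below, and `K` makes its term at least `1`, which suffices because `f ≤ 0` and `c
    -- ≥ -1`.
    have h1 := husc _ hRmem (c + ε) (by have := hs R ⟨hR, le_rfl⟩; linarith)
    obtain ⟨δ, hδ, hδ'⟩ := Metric.mem_nhdsWithin_iff.1 h1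
    have hpos : 0 < √(δ ^ 2 / (4 * R)) := Real.sqrt_pos.2 (by positivity)
    refine ⟨1 / √(δ ^ 2 / (4 * R)), by positivity, fun z hz => ?_⟩
    have hzR : z ∈ Metric.closedBall (0 : ℂ) R := by simp [hz]
    by_cases hd : dist z (-(R : ℂ)) < δ
    · have h2 : f z < c + ε := hδ' ⟨hd, hzR⟩
      have : 0 ≤ 1 / √(δ ^ 2 / (4 * R)) * √((‖z‖ + z.re) / 2) := by positivity
      linarith
    · push Not at hd
      have h3 : δ ^ 2 ≤ 2 * R * (R + z.re) := by
        have h4 : dist z (-(R : ℂ)) ^ 2 = 2 * R * (R + z.re) := by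
          rw [dist_eq_norm, sub_neg_eq_add, Complex.sq_norm, Complex.normSq_apply]
          have h5 : z.re * z.re + z.im * z.im = R ^ 2 := by
            rw [← hz, Complex.sq_norm, Complex.normSq_apply]
          simp only [Complex.add_re, Complex.add_im, Complex.ofReal_re, Complex.ofReal_im]
          linarith
        rw [← h4]
        exact pow_le_pow_left₀ hδ.le hd 2
      have h6 : √(δ ^ 2 / (4 * R)) ≤ √((‖z‖ + z.re) / 2) := by
        refine Real.sqrt_le_sqrt ?_
        rw [hz, div_le_iff₀ (by positivity)]
        linarith
      have h7 : 1 ≤ 1 / √(δ ^ 2 / (4 * R)) * √((‖z‖ + z.re) / 2) := by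
        rw [div_mul_eq_mul_div, one_mul]
        exact (one_le_div hpos).2 h6
      have := hf0 z hzR
      linarith
  obtain ⟨r, hr, hrR, hKr⟩ : ∃ r : ℝ, 0 < r ∧ r ≤ R ∧ K * √r ≤ ε := by
    have hcont : Tendsto (fun r : ℝ => K * √r) (𝓝[>] 0) (𝓝 0) := by
      have : Continuous fun r : ℝ => K * √r := by fun_prop
      have := (this.tendsto 0).mono_left (nhdsWithin_le_nhds (s := Set.Ioi 0))
      simpa using this
    obtain ⟨r, h1, h2, h3⟩ := ((hcont.eventually_lt_const hε).and
      ((Ioc_mem_nhdsGT hR : Set.Ioc 0 R ∈ 𝓝[>] (0 : ℝ)))).exists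
    exact ⟨r, h2, h3, h1.le⟩
  -- On `‖w‖ = r` the root, logarithmic and quadratic terms are each at most `ε`, so `f ≤ c + 4ε`
  -- there, whereas `f 0 = c + 5ε`.
  set η := ε / (1 + (Real.log R - Real.log r)) with hη
  have hlog : 0 ≤ Real.log R - Real.log r := sub_nonneg.2 (Real.log_le_log hr hrR)
  have hη0 : 0 < η := by positivity
  have hη1 : η * (Real.log R - Real.log r) ≤ ε := by
    rw [hη, div_mul_eq_mul_div, div_le_iff₀ (by positivity)]
    nlinarith
  have hκ1 : ε / R ^ 2 * R ^ 2 = ε := by field_simp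
  have hmain : f 0 ≤ (((c + 4 * ε : ℝ) : ℂ)).re := by
    refine le_re_of_le_re_on_sphere (F := fun _ => ((c + 4 * ε : ℝ) : ℂ)) hr
      (hf0 0 (by simp [hR.le])) (hm 0 r fun ζ hζ => ?_) diffContOnCl_const fun w hw => ?_
    · rw [mem_closedBall_zero_iff, zero_add, smul_eq_mul, norm_mul, Complex.norm_real,
        Real.norm_of_nonneg hr.le]
      exact (mul_le_of_le_one_left hr.le hζ).trans hrR
    · have hwr : ‖w‖ = r := by simpa using hw
      have hw0 : w ≠ 0 := by rw [← norm_pos_iff, hwr]; exact hr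
      have h1 := le_of_le_on_slit_boundary hR husc hf0 hc hm hs hε hK hη0
        (κ := ε / R ^ 2) (by positivity) hbd hw0 (hwr ▸ hrR)
      have h2 : K * √((‖w‖ + w.re) / 2) ≤ K * √r := by
        refine mul_le_mul_of_nonneg_left (Real.sqrt_le_sqrt ?_) hK
        have := Complex.re_le_norm w
        linarith
      have h3 : 0 ≤ ε / R ^ 2 * ‖w‖ ^ 2 := by positivity
      rw [mul_sub (ε / R ^ 2), hκ1] at h1
      rw [hwr] at h1 h3 h2
      rw [Complex.ofReal_re]
      linarith
  rw [Complex.ofReal_re] at hmain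
  have : f 0 - c = 5 * ε := by rw [hεdef]; ring
  linarith

/-! ### Passage between extended real and bounded real functions -/

theorem add_exp_smul_mem {V : Type*} [AddCommGroup V] [Module ℂ V] {S : Set V} {a b : V}
    (h : ∀ ζ : ℂ, ‖ζ‖ ≤ 1 → a + ζ • b ∈ S) (t : ℝ) :
    a + Complex.exp (2 * Real.pi * t * Complex.I) • b ∈ S :=
  h _ (norm_exp_two_pi_mul t).le

theorem center_mem {V : Type*} [AddCommGroup V] [Module ℂ V] {S : Set V} {a b : V}
    (h : ∀ ζ : ℂ, ‖ζ‖ ≤ 1 → a + ζ • b ∈ S) : a ∈ S := by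
  simpa using h 0 (by simp)

theorem coe_neg_one : ((-1 : ℝ) : EReal) = -1 := by simp

theorem unitIntegral_of_nonpos {f : ℝ → EReal} (hf : ∀ t, f t ≤ 0) :
    unitIntegral f = -((∫⁻ t in Set.Icc (0 : ℝ) 1, (-f t).toENNReal : ENNReal) : EReal) := by
  simp [unitIntegral, EReal.toENNReal_of_nonpos (hf _)]

theorem coe_mem_PSHNeg {n : ℕ} {D : Set (Fin n → ℂ)} {v : (Fin n → ℂ) → ℝ}
    (husc : UpperSemicontinuousOn v D) (h0 : ∀ z ∈ D, v z ≤ 0) (hm : SubMeanOn D v) :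
    (fun z => (v z : EReal)) ∈ PSHNeg D := by
  refine ⟨⟨fun z _ => EReal.coe_lt_top _, ?_, fun a b hab => ?_⟩,
    fun z hz => EReal.coe_nonpos.2 (h0 z hz)⟩
  · exact continuous_coe_real_ereal.comp_upperSemicontinuousOn husc
      fun x y h => EReal.coe_le_coe_iff.2 h
  · rw [unitIntegral_of_nonpos fun t => EReal.coe_nonpos.2 (h0 _ (add_exp_smul_mem hab t)),
      EReal.le_neg]
    have h1 := hm a b hab
    have h2 : ((ENNReal.ofReal (-v a) : ENNReal) : EReal) = -(v a : EReal) := by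
      rw [EReal.coe_ennreal_ofReal, max_eq_left (neg_nonneg.2 (h0 a (center_mem hab))),
        EReal.coe_neg]
    rw [← h2]
    exact EReal.coe_ennreal_le_coe_ennreal_iff.2 h1

/-- The truncation `max u (-1)` as a real function. -/
noncomputable def truncation {n : ℕ} (u : (Fin n → ℂ) → EReal) (z : Fin n → ℂ) : ℝ :=
  (max (u z) (-1)).toReal

section truncation

variable {n : ℕ} {D : Set (Fin n → ℂ)} {u : (Fin n → ℂ) → EReal}

theorem coe_truncation {z : Fin n → ℂ} (hu : u z ≤ 0) :
    (truncation u z : EReal) = max (u z) (-1) := by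
  refine EReal.coe_toReal (fun h => ?_) (fun h => ?_)
  · have : max (u z) (-1) ≤ 0 := max_le hu (by norm_num)
    rw [h] at this
    exact absurd this (by simp)
  · have : (-1 : EReal) ≤ max (u z) (-1) := le_max_right _ _
    rw [h] at this
    exact absurd this (by decide)

theorem truncation_nonpos {z : Fin n → ℂ} (hu : u z ≤ 0) : truncation u z ≤ 0 := by
  have : (truncation u z : EReal) ≤ 0 := by
    rw [coe_truncation hu]
    exact max_le hu (by norm_num)
  exact_mod_cast this

theorem neg_one_le_truncation {z : Fin n → ℂ} (hu : u z ≤ 0) : -1 ≤ truncation u z := by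
  have : (-1 : EReal) ≤ (truncation u z : EReal) := by
    rw [coe_truncation hu]
    exact le_max_right _ _
  rwa [← coe_neg_one, EReal.coe_le_coe_iff] at this

theorem le_coe_truncation {z : Fin n → ℂ} (hu : u z ≤ 0) : u z ≤ (truncation u z : EReal) := by
  rw [coe_truncation hu]
  exact le_max_left _ _

theorem truncation_lt {z : Fin n → ℂ} (hu : u z ≤ 0) {c : ℝ} (hc : -1 < c) (h : u z < c) :
    truncation u z < c := by
  have : (truncation u z : EReal) < c := by
    rw [coe_truncation hu]
    exact max_lt h (coe_neg_one ▸ EReal.coe_lt_coe_iff.2 hc)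
  exact_mod_cast this

theorem upperSemicontinuousOn_truncation (hu : u ∈ PSHNeg D) :
    UpperSemicontinuousOn (truncation u) D := by
  intro x hx c hc
  have h1 : u x < c := (le_coe_truncation (hu.2 x hx)).trans_lt (by exact_mod_cast hc)
  filter_upwards [hu.1.usc x hx c h1, self_mem_nhdsWithin] with y hy hyD
  exact truncation_lt (hu.2 y hyD) ((neg_one_le_truncation (hu.2 x hx)).trans_lt hc) hy

theorem subMeanOn_truncation (hu : u ∈ PSHNeg D) : SubMeanOn D (truncation u) := by
  intro a b hab
  have ha := hu.2 a (center_mem hab)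
  -- Where `u a ≤ -1` the right side is `1`, which bounds every mean. Otherwise truncation leaves `u
  -- a` unchanged and only decreases the integrand `-u`.
  rcases le_or_gt (u a) (-1) with h | h
  · have h1 : truncation u a = -1 := by
      have := coe_truncation ha
      rwa [max_eq_right h, ← coe_neg_one, EReal.coe_eq_coe_iff] at this
    rw [h1]
    calc _ ≤ ∫⁻ _ in Set.Icc (0 : ℝ) 1, ENNReal.ofReal (-(-1)) :=
          lintegral_mono fun t => ENNReal.ofReal_le_ofReal
            (neg_le_neg (neg_one_le_truncation (hu.2 _ (add_exp_smul_mem hab t))))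
      _ = _ := by simp
  · have h1 : -(truncation u a : EReal) = -u a := by rw [coe_truncation ha, max_eq_left h.le]
    have h2 := hu.1.sub_mean a b hab
    rw [unitIntegral_of_nonpos fun t => hu.2 _ (add_exp_smul_mem hab t), EReal.le_neg, ← h1] at h2
    have h3 := EReal.toENNReal_le_toENNReal h2
    rw [EReal.toENNReal_coe, ← EReal.coe_neg, EReal.real_coe_toENNReal] at h3
    refine le_trans (lintegral_mono fun t => ?_) h3
    rw [← EReal.real_coe_toENNReal, EReal.coe_neg]
    exact EReal.toENNReal_le_toENNReal (EReal.neg_le_neg_iff.2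
      (le_coe_truncation (hu.2 _ (add_exp_smul_mem hab t))))

end truncation

/-! ### Restriction to complex lines -/

section segment

variable {V : Type*} [NormedAddCommGroup V] [NormedSpace ℂ V] {D : Set V} {v : V → ℝ}

theorem SubMeanOn.comp_affine {T : Set ℂ} (hm : SubMeanOn D v) (z b : V)
    (hT : ∀ ζ ∈ T, z + ζ • b ∈ D) : SubMeanOn T fun ζ : ℂ => v (z + ζ • b) := by
  intro p q hpq
  have h := hm (z + p • b) (q • b) fun ζ hζ => by
    have := hT _ (hpq ζ hζ)
    rwa [smul_eq_mul, add_smul, mul_smul, ← add_assoc] at this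
  simpa only [smul_eq_mul, add_smul, mul_smul, ← add_assoc] using h

/-- If `v` were at most `c` on a whole initial piece of the segment, its restriction to the complex
line through `z` in direction `b` would contradict `le_of_le_on_segment`. -/
theorem frequently_lt_along_segment (hD : IsOpen D) (husc : UpperSemicontinuousOn v D)
    (h0 : ∀ z ∈ D, v z ≤ 0) (h1 : ∀ z ∈ D, -1 ≤ v z) (hm : SubMeanOn D v) {z : V} (hz : z ∈ D)
    (b : V) {c : ℝ} (hc : c < v z) : ∃ᶠ t : ℝ in 𝓝[>] 0, c < v (z - (t : ℂ) • b) := by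
  intro hev
  simp only [not_lt] at hev
  obtain ⟨δ, hδ, hδ'⟩ := mem_nhdsGT_iff_exists_Ioc_subset.1 hev
  have hg : Continuous fun ζ : ℂ => z + ζ • b := by fun_prop
  have hnhds : {ζ : ℂ | z + ζ • b ∈ D} ∈ 𝓝 (0 : ℂ) :=
    (hD.preimage hg).mem_nhds (by simpa using hz)
  obtain ⟨R, hR, hRD⟩ := Metric.nhds_basis_closedBall.mem_iff.1 hnhds
  have hS : ∀ ζ ∈ Metric.closedBall (0 : ℂ) (min R δ), z + ζ • b ∈ D := fun ζ hζ =>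
    hRD (Metric.closedBall_subset_closedBall (min_le_left _ _) hζ)
  have := le_of_le_on_segment (f := fun ζ : ℂ => v (z + ζ • b)) (c := c) (lt_min hR hδ)
    (husc.comp hg.continuousOn hS) (fun ζ hζ => h0 _ (hS ζ hζ)) (fun ζ hζ => h1 _ (hS ζ hζ))
    (hm.comp_affine z b hS) fun s hs => by
      have := hδ' ⟨hs.1, hs.2.trans (min_le_right _ _)⟩
      simpa [sub_eq_add_neg] using this
  simp only [zero_smul, add_zero] at this
  linarith

end segment

/-! ### Continuous regularization by sup-convolution -/

section supConvolution

variable {V : Type*} [NormedAddCommGroup V] {D : Set V} {v : V → ℝ}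

/-- The sup-convolution of `v` with the cone of slope `j`. -/
noncomputable def supConvolution (D : Set V) (v : V → ℝ) (j : ℝ) (x : V) : ℝ :=
  ⨆ w : D, (v w - j * dist (w : V) x)

theorem bddAbove_supConvolution (h0 : ∀ z ∈ D, v z ≤ 0) {j : ℝ} (hj : 0 ≤ j) (x : V) :
    BddAbove (Set.range fun w : D => v w - j * dist (w : V) x) :=
  ⟨0, by
    rintro _ ⟨w, rfl⟩
    have := h0 w w.2
    have : 0 ≤ j * dist (w : V) x := by positivity
    simp only
    linarith⟩

theorem le_supConvolution (h0 : ∀ z ∈ D, v z ≤ 0) {j : ℝ} (hj : 0 ≤ j) (x : V) {w : V}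
    (hw : w ∈ D) : v w - j * dist w x ≤ supConvolution D v j x :=
  le_ciSup (bddAbove_supConvolution h0 hj x) (⟨w, hw⟩ : D)

theorem self_le_supConvolution (h0 : ∀ z ∈ D, v z ≤ 0) {j : ℝ} (hj : 0 ≤ j) {x : V} (hx : x ∈ D) :
    v x ≤ supConvolution D v j x := by
  simpa using le_supConvolution h0 hj x hx

theorem supConvolution_nonpos (h0 : ∀ z ∈ D, v z ≤ 0) {j : ℝ} (hj : 0 ≤ j) (x : V) :
    supConvolution D v j x ≤ 0 := by
  refine Real.iSup_nonpos fun w => ?_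
  have := h0 w w.2
  have : 0 ≤ j * dist (w : V) x := by positivity
  linarith

theorem continuous_supConvolution (hne : D.Nonempty) (h0 : ∀ z ∈ D, v z ≤ 0) {j : ℝ} (hj : 0 ≤ j) :
    Continuous (supConvolution D v j) := by
  have : Nonempty D := hne.to_subtype
  refine (LipschitzWith.of_le_add_mul (Real.toNNReal j) fun x y => ?_).continuous
  rw [Real.coe_toNNReal j hj]
  refine ciSup_le fun w => ?_
  have h1 := le_supConvolution h0 hj y w.2
  have h2 := mul_le_mul_of_nonneg_left (dist_triangle (w : V) x y) hj
  linarith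

/-- The bound `-1 ≤ v x` localizes the supremum: once `j * δ ≥ 1`, points at distance at least `δ`
contribute at most `-1`. Nearer points are controlled by semicontinuity at `x`. -/
theorem tendsto_supConvolution (husc : UpperSemicontinuousOn v D) (h0 : ∀ z ∈ D, v z ≤ 0)
    (h1 : ∀ z ∈ D, -1 ≤ v z) {x : V} (hx : x ∈ D) :
    Tendsto (fun j => supConvolution D v j x) atTop (𝓝 (v x)) := by
  have : Nonempty D := ⟨⟨x, hx⟩⟩
  rw [tendsto_order]
  constructor
  · intro c hc
    filter_upwards [eventually_ge_atTop 0] with j hj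
    exact hc.trans_le (self_le_supConvolution h0 hj hx)
  · intro c hc
    obtain ⟨c', hc1, hc2⟩ := exists_between hc
    obtain ⟨δ, hδ, hδ'⟩ := Metric.mem_nhdsWithin_iff.1 (husc x hx c' hc1)
    filter_upwards [eventually_ge_atTop (1 / δ)] with j hj
    have hj0 : 0 ≤ j := (by positivity : (0 : ℝ) ≤ 1 / δ).trans hj
    refine lt_of_le_of_lt (ciSup_le fun w => ?_) hc2
    rcases lt_or_ge (dist (w : V) x) δ with hd | hd
    · have h2 : v w < c' := hδ' ⟨hd, w.2⟩
      have : 0 ≤ j * dist (w : V) x := by positivity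
      linarith
    · have h2 : 1 ≤ j * dist (w : V) x := by
        calc (1 : ℝ) = 1 / δ * δ := by field_simp
          _ ≤ _ := mul_le_mul hj hd hδ.le hj0
      have := h0 w w.2
      have := h1 x hx
      linarith

variable [NormedSpace ℂ V]

/-- The sup-convolution, composed with a linear map that sends `S` well inside `D`, inherits the
sub-mean value inequality. -/
theorem subMeanOn_supConvolution_comp (h0 : ∀ z ∈ D, v z ≤ 0) (h1 : ∀ z ∈ D, -1 ≤ v z)
    (hm : SubMeanOn D v) {S : Set V} {T : V →ₗ[ℂ] V} {δ : ℝ} (hδ : 0 < δ)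
    (hT : ∀ x ∈ S, ∀ w, dist w (T x) < δ → w ∈ D) {j : ℝ} (hj : 1 / δ ≤ j) :
    SubMeanOn S fun x => supConvolution D v j (T x) := by
  intro a b hab
  have hj0 : 0 < j := (by positivity : (0 : ℝ) < 1 / δ).trans_le hj
  have hTD : ∀ x ∈ S, T x ∈ D := fun x hx => hT x hx _ (by simpa using hδ)
  have : Nonempty D := ⟨⟨T a, hTD a (center_mem hab)⟩⟩
  set W := fun x => supConvolution D v j (T x) with hW
  set I := ∫⁻ t in Set.Icc (0 : ℝ) 1,
      ENNReal.ofReal (-W (a + Complex.exp (2 * Real.pi * t * Complex.I) • b)) with hI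
  have key : ∀ w ∈ D, I ≤ ENNReal.ofReal (-(v w - j * dist w (T a))) := by
    intro w hw
    -- A competitor `w` with penalty at least `1` has value at most `-1`, hence is harmless. Any
    -- other lies within `δ` of `T a`, and its whole disc, translated along with `T (a + ζ • b)`,
    -- stays in `D` at constant penalty.
    rcases le_or_gt 1 (j * dist w (T a)) with hd | hd
    · calc I ≤ ∫⁻ _ in Set.Icc (0 : ℝ) 1, ENNReal.ofReal 1 :=
            lintegral_mono fun t => ENNReal.ofReal_le_ofReal (by
              have hx := hTD _ (add_exp_smul_mem hab t)
              have := self_le_supConvolution h0 hj0.le hx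
              have := h1 _ hx
              simp only [hW]
              linarith)
        _ = ENNReal.ofReal 1 := by simp
        _ ≤ _ := ENNReal.ofReal_le_ofReal (by linarith [h0 w hw])
    · have hdδ : ‖w - T a‖ < δ := by
        rw [← dist_eq_norm]
        by_contra! hcon
        have : 1 ≤ j * dist w (T a) := by
          calc (1 : ℝ) = 1 / δ * δ := by field_simp
            _ ≤ _ := mul_le_mul hj hcon hδ.le hj0.le
        linarith
      have hshift : ∀ ζ : ℂ, w + ζ • T b - T (a + ζ • b) = w - T a := fun ζ => by
        rw [map_add, map_smul]; abel
      have hdisc : ∀ ζ : ℂ, ‖ζ‖ ≤ 1 → w + ζ • T b ∈ D := fun ζ hζ =>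
        hT _ (hab ζ hζ) _ (by rwa [dist_eq_norm, hshift])
      have hnn : 0 ≤ -v w := neg_nonneg.2 (h0 w hw)
      calc I ≤ ∫⁻ t in Set.Icc (0 : ℝ) 1,
            (ENNReal.ofReal (-v (w + Complex.exp (2 * Real.pi * t * Complex.I) • T b)) +
              ENNReal.ofReal (j * dist w (T a))) := lintegral_mono fun t => by
              have hx := add_exp_smul_mem hdisc t
              have h2 := le_supConvolution h0 hj0.le
                (T (a + Complex.exp (2 * Real.pi * t * Complex.I) • b)) hx
              rw [dist_eq_norm, hshift, ← dist_eq_norm] at h2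
              rw [← ENNReal.ofReal_add (neg_nonneg.2 (h0 _ hx)) (by positivity)]
              refine ENNReal.ofReal_le_ofReal ?_
              simp only [hW]
              linarith
        _ = (∫⁻ t in Set.Icc (0 : ℝ) 1,
            ENNReal.ofReal (-v (w + Complex.exp (2 * Real.pi * t * Complex.I) • T b))) +
              ENNReal.ofReal (j * dist w (T a)) := by
              rw [lintegral_add_right _ measurable_const]; simp
        _ ≤ ENNReal.ofReal (-v w) + ENNReal.ofReal (j * dist w (T a)) := by
              gcongr
              exact hm w (T b) hdisc
        _ = _ := by
              rw [← ENNReal.ofReal_add hnn (by positivity)]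
              congr 1
              ring
  have hIfin : I ≠ ⊤ :=
    ((key _ (hTD a (center_mem hab))).trans_lt ENNReal.ofReal_lt_top).ne
  refine (ENNReal.le_ofReal_iff_toReal_le hIfin ?_).2 ?_
  · exact neg_nonneg.2 (supConvolution_nonpos h0 hj0.le _)
  · rw [le_neg]
    refine ciSup_le fun w => ?_
    have h2 := key w w.2
    have h3 : 0 ≤ j * dist (w : V) (T a) := by positivity
    have h4 := h0 w w.2
    rw [ENNReal.le_ofReal_iff_toReal_le hIfin (by linarith)] at h2
    linarith

end supConvolution

/-! ### Separation by a measure -/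

/-- A convex set of continuous functions on a compact space, none of which is everywhere less than
`ε`, is bounded below by a positive constant under integration against some finite measure. -/
theorem exists_measure_le_integral {X : Type*} [TopologicalSpace X] [T2Space X] [CompactSpace X]
    [MeasurableSpace X] [BorelSpace X] {C : Set C(X, ℝ)} (hC : Convex ℝ C) {ε : ℝ} (hε : 0 < ε)
    (hCε : ∀ f ∈ C, ¬ ∀ x, f x < ε) :
    ∃ μ : Measure X, IsFiniteMeasure μ ∧ ∃ s : ℝ, 0 < s ∧ ∀ f ∈ C, s ≤ ∫ x, f x ∂μ := by
  set O : Set C(X, ℝ) := {f | ∀ x, f x < ε} with hO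
  have hOo : IsOpen O := by
    have := ContinuousMap.isOpen_setOfPred_mapsTo (X := X) isCompact_univ (isOpen_Iio (a := ε))
    simpa [Set.MapsTo] using this
  have hOc : Convex ℝ O := by
    intro f hf g hg a b ha hb hab x
    have : a • f x + b • g x ∈ Set.Iio ε := (convex_Iio ε) (hf x) (hg x) ha hb hab
    exact this
  obtain ⟨L, s, hLO, hLC⟩ := geometric_hahn_banach_open hOc hOo hC
    (Set.disjoint_left.2 fun f hfO hfC => hCε f hfC hfO)
  have hs : 0 < s := by
    have : (0 : C(X, ℝ)) ∈ O := fun x => by simpa using hε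
    simpa using hLO 0 this
  have hpos : ∀ g : C(X, ℝ), (∀ x, 0 ≤ g x) → 0 ≤ L g := by
    intro g hg
    by_contra! hneg
    -- This multiple of `g` is non-positive, hence in `O`, yet `L` takes the value `s` on it,
    -- whereas `L < s` on `O`.
    have hmem : (s / L g) • g ∈ O := fun x => by
      have h1 : s / L g ≤ 0 := (div_neg_of_pos_of_neg hs hneg).le
      have : s / L g * g x ≤ 0 := mul_nonpos_of_nonpos_of_nonneg h1 (hg x)
      simpa using this.trans_lt hε
    have := hLO _ hmem
    rw [map_smul, smul_eq_mul, div_mul_cancel₀ _ hneg.ne] at this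
    exact lt_irrefl _ this
  let Λ₀ : CompactlySupportedContinuousMap X ℝ →ₗ[ℝ] ℝ :=
    { toFun := fun f => L (f : C(X, ℝ))
      map_add' := fun f g => by rw [← map_add]; rfl
      map_smul' := fun a f => by rw [RingHom.id_apply, ← map_smul]; rfl }
  let Λ : CompactlySupportedContinuousMap X ℝ →ₚ[ℝ] ℝ :=
    PositiveLinearMap.mk₀ Λ₀ fun f hf => hpos _ fun x => hf x
  refine ⟨RealRMK.rieszMeasure Λ, ?_, s, hs, fun f hf => ?_⟩
  · infer_instance
  · have h1 := RealRMK.integral_rieszMeasure Λ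
      (CompactlySupportedContinuousMap.continuousMapEquiv f)
    have h2 : Λ (CompactlySupportedContinuousMap.continuousMapEquiv f) = L f := rfl
    rw [h2] at h1
    exact (hLC f hf).trans h1.ge

/-! ### Convex combinations of continuous candidates -/

section candidates

variable {V : Type*} [NormedAddCommGroup V] [NormedSpace ℂ V] {D : Set V} {v w : V → ℝ}

theorem SubMeanOn.const_mul (hv : SubMeanOn D v) {c : ℝ} (hc : 0 ≤ c) :
    SubMeanOn D fun z => c * v z := by
  intro a b hab
  simp only [← mul_neg, ENNReal.ofReal_mul hc]
  rw [lintegral_const_mul' _ _ ENNReal.ofReal_ne_top]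
  gcongr
  exact hv a b hab

/-- Additivity of the lower Lebesgue integral is secured by one measurable summand, here the
continuous `v`. -/
theorem SubMeanOn.add (hv : SubMeanOn D v) (hw : SubMeanOn D w) (hvc : ContinuousOn v D)
    (hv0 : ∀ z ∈ D, v z ≤ 0) (hw0 : ∀ z ∈ D, w z ≤ 0) : SubMeanOn D fun z => v z + w z := by
  intro a b hab
  have ha := center_mem hab
  have hcont : Continuous fun t : ℝ =>
      v (a + Complex.exp (2 * Real.pi * t * Complex.I) • b) :=
    hvc.comp_continuous (by fun_prop) fun t => add_exp_smul_mem hab t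
  calc _ = ∫⁻ t in Set.Icc (0 : ℝ) 1,
        (ENNReal.ofReal (-v (a + Complex.exp (2 * Real.pi * t * Complex.I) • b)) +
          ENNReal.ofReal (-w (a + Complex.exp (2 * Real.pi * t * Complex.I) • b))) := by
        refine lintegral_congr fun t => ?_
        have ht := add_exp_smul_mem hab t
        rw [neg_add, ENNReal.ofReal_add (neg_nonneg.2 (hv0 _ ht)) (neg_nonneg.2 (hw0 _ ht))]
    _ = _ := lintegral_add_left hcont.neg.measurable.ennreal_ofReal _
    _ ≤ ENNReal.ofReal (-v a) + ENNReal.ofReal (-w a) := add_le_add (hv a b hab) (hw a b hab)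
    _ = _ := by
        rw [neg_add, ENNReal.ofReal_add (neg_nonneg.2 (hv0 _ ha)) (neg_nonneg.2 (hw0 _ ha))]

/-- The non-positive functions that are plurisubharmonic on `D`, continuous on its closure, and at
least `s` at the point `z`. -/
def continuousCandidates (D : Set V) (z : V) (s : ℝ) : Set (V → ℝ) :=
  {v | ContinuousOn v (closure D) ∧ (∀ x ∈ D, v x ≤ 0) ∧ SubMeanOn D v ∧ s ≤ v z}

theorem convex_continuousCandidates (D : Set V) (z : V) (s : ℝ) :
    Convex ℝ (continuousCandidates D z s) := by
  rintro v ⟨hv1, hv2, hv3, hv4⟩ w ⟨hw1, hw2, hw3, hw4⟩ α β hα hβ hαβ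
  refine ⟨(hv1.const_smul α).add (hw1.const_smul β), fun x hx => ?_, ?_, ?_⟩
  · exact add_nonpos (mul_nonpos_of_nonneg_of_nonpos hα (hv2 x hx))
      (mul_nonpos_of_nonneg_of_nonpos hβ (hw2 x hx))
  · exact (hv3.const_mul hα).add (hw3.const_mul hβ)
      ((hv1.mono subset_closure).const_smul α)
      (fun x hx => mul_nonpos_of_nonneg_of_nonpos hα (hv2 x hx))
      (fun x hx => mul_nonpos_of_nonneg_of_nonpos hβ (hw2 x hx))
  · have h1 := mul_le_mul_of_nonneg_left hv4 hα
    have h2 := mul_le_mul_of_nonneg_left hw4 hβ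
    have h3 : α * s + β * s = s := by rw [← add_mul, hαβ, one_mul]
    simp only [Pi.add_apply, Pi.smul_apply, smul_eq_mul]
    linarith

theorem supConvolution_comp_mem_continuousCandidates (h0 : ∀ z ∈ D, v z ≤ 0)
    (h1 : ∀ z ∈ D, -1 ≤ v z) (hm : SubMeanOn D v) {T : V →L[ℂ] V} {δ : ℝ} (hδ : 0 < δ)
    (hT : ∀ x ∈ closure D, ∀ y, dist y (T x) < δ → y ∈ D) {z : V} (hz : z ∈ D) {s : ℝ}
    (hs : s ≤ v (T z)) {j : ℝ} (hj : 1 / δ ≤ j) :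
    (fun x => supConvolution D v j (T x)) ∈ continuousCandidates D z s := by
  have hj0 : 0 ≤ j := (by positivity : (0 : ℝ) ≤ 1 / δ).trans hj
  have hzD : T z ∈ D := hT z (subset_closure hz) _ (by simpa using hδ)
  refine ⟨((continuous_supConvolution ⟨z, hz⟩ h0 hj0).comp T.continuous).continuousOn,
    fun x _ => supConvolution_nonpos h0 hj0 _, ?_, hs.trans (self_le_supConvolution h0 hj0 hzD)⟩
  exact subMeanOn_supConvolution_comp (T := (T : V →ₗ[ℂ] V)) h0 h1 hm hδ
    (fun x hx y hy => hT x (subset_closure hx) y hy) hj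

/-- A Mazur type argument. A separating measure `μ` would give `∫ (w + 1) ≥ r > 0` for all
candidates `w`. The bound passes to `v ∘ T k` as the slope `j → ∞`, and then fails as `k → ∞`, since
`v ∘ T k + 1 → 0` boundedly on `A`. -/
theorem exists_candidate_lt [MeasurableSpace V] [BorelSpace V] (hD : IsOpen D)
    (hDc : IsCompact (closure D)) {A : Set V} (hA : IsCompact A) (hAD : A ⊆ closure D)
    (husc : UpperSemicontinuousOn v D) (h0 : ∀ z ∈ D, v z ≤ 0) (h1 : ∀ z ∈ D, -1 ≤ v z)
    (hm : SubMeanOn D v) {z : V} (hz : z ∈ D) {T : ℕ → V →L[ℂ] V}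
    (hT : ∀ k, ∀ x ∈ closure D, T k x ∈ D)
    (hlim : ∀ ζ ∈ A, Tendsto (fun k => v (T k ζ)) atTop (𝓝 (-1)))
    {s : ℝ} (hs : ∀ k, s ≤ v (T k z)) {ε : ℝ} (hε : 0 < ε) :
    ∃ w ∈ continuousCandidates D z s, ∀ ζ ∈ A, w ζ < -1 + ε := by
  have : CompactSpace A := isCompact_iff_compactSpace.1 hA
  set C : Set C(A, ℝ) := {f | ∃ w ∈ continuousCandidates D z s, ∀ a : A, f a = w a + 1} with hC
  have hCc : Convex ℝ C := by
    rintro f ⟨w, hw, hfw⟩ g ⟨y, hy, hgy⟩ α β hα hβ hαβ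
    refine ⟨α • w + β • y, convex_continuousCandidates D z s hw hy hα hβ hαβ, fun a => ?_⟩
    simp only [ContinuousMap.add_apply, ContinuousMap.smul_apply, hfw, hgy, Pi.add_apply,
      Pi.smul_apply, smul_eq_mul]
    linear_combination hαβ
  by_contra! hcon
  obtain ⟨μ, hμ, r, hr, hrC⟩ := exists_measure_le_integral hCc hε (by
    rintro f ⟨w, hw, hfw⟩ hlt
    obtain ⟨ζ, hζ, hge⟩ := hcon w hw
    have := hlt ⟨ζ, hζ⟩
    rw [hfw] at this
    simp only at this
    linarith)
  have hbound : ∀ k (a : A), ‖v (T k a) + 1‖ ≤ 1 := fun k a => by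
    have hx := hT k a (hAD a.2)
    have := h0 _ hx
    have := h1 _ hx
    rw [Real.norm_eq_abs, abs_le]
    constructor <;> linarith
  have hk : ∀ k, AEStronglyMeasurable (fun a : A => v (T k a) + 1) μ ∧
      r ≤ ∫ a : A, (v (T k a) + 1) ∂μ := by
    intro k
    obtain ⟨δ, hδ, hδD⟩ := (hDc.image (T k).continuous).exists_thickening_subset_open hD
      (Set.image_subset_iff.2 (hT k))
    have hTδ : ∀ x ∈ closure D, ∀ y, dist y (T k x) < δ → y ∈ D := fun x hx y hy =>
      hδD (Metric.mem_thickening_iff.2 ⟨_, Set.mem_image_of_mem _ hx, hy⟩)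
    have hcont : ∀ᶠ j : ℝ in atTop,
        Continuous fun a : A => supConvolution D v j (T k a) + 1 := by
      filter_upwards [eventually_ge_atTop 0] with j hj
      have := continuous_supConvolution ⟨z, hz⟩ h0 hj
      have := (T k).continuous
      fun_prop
    have hmeas : ∀ᶠ j : ℝ in atTop,
        AEStronglyMeasurable (fun a : A => supConvolution D v j (T k a) + 1) μ :=
      hcont.mono fun j hj => hj.aestronglyMeasurable
    have hpt : ∀ a : A, Tendsto (fun j => supConvolution D v j (T k a) + 1) atTop
        (𝓝 (v (T k a) + 1)) := fun a =>
      (tendsto_supConvolution husc h0 h1 (hT k a (hAD a.2))).add_const 1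
    have hlimint := tendsto_integral_filter_of_dominated_convergence (μ := μ) (fun _ => (1 : ℝ))
      hmeas (by
        filter_upwards [eventually_ge_atTop 0] with j hj
        refine Eventually.of_forall fun a => ?_
        have hx := hT k a (hAD a.2)
        have := supConvolution_nonpos h0 hj (T k a)
        have := self_le_supConvolution h0 hj hx
        have := h1 _ hx
        rw [Real.norm_eq_abs, abs_le]
        constructor <;> linarith) (integrable_const _) (Eventually.of_forall hpt)
    obtain ⟨N, hN⟩ := eventually_atTop.1 hmeas
    -- Measurability of the limit is read off the slopes `max N j`, all of which lie in the range
    -- where measurability is known.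
    refine ⟨aestronglyMeasurable_of_tendsto_ae atTop
      (f := fun (j : ℕ) (a : A) => supConvolution D v (max N j) (T k a) + 1)
      (fun j => hN _ (le_max_left _ _))
      (Eventually.of_forall fun a => (hpt a).comp
        (tendsto_atTop_mono (fun j => le_max_right N (j : ℝ)) tendsto_natCast_atTop_atTop)), ?_⟩
    refine ge_of_tendsto hlimint ?_
    filter_upwards [hcont, eventually_ge_atTop (1 / δ)] with j hj hjδ
    exact hrC ⟨_, hj⟩ ⟨_, supConvolution_comp_mem_continuousCandidates h0 h1 hm hδ hTδ hz
      (hs k) hjδ, fun a => rfl⟩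
  have hfin := tendsto_integral_of_dominated_convergence (μ := μ)
    (F := fun k (a : A) => v (T k a) + 1) (f := fun _ => (0 : ℝ)) (fun _ => (1 : ℝ))
    (fun k => (hk k).1) (integrable_const _) (fun k => Eventually.of_forall (hbound k))
    (Eventually.of_forall fun a => by simpa using (hlim a a.2).add_const 1)
  rw [integral_zero] at hfin
  exact absurd (ge_of_tendsto' hfin fun k => (hk k).2) (not_le.2 hr)

end candidates

/-! ### Domination by the extremal function of continuous candidates -/

variable {n : ℕ} {D A : Set (Fin n → ℂ)}

theorem coe_le_omegaC {w : (Fin n → ℂ) → ℝ} (hw : (fun x => (w x : EReal)) ∈ PSHNeg D)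
    (hwc : ContinuousOn w (closure D)) (hwA : ∀ ζ ∈ A, w ζ ≤ -1) (z : Fin n → ℂ) :
    (w z : EReal) ≤ omegaC D A z :=
  le_sSup ⟨w, hw, hwc, hwA, rfl⟩

/-- If `u` is at most `-1` at the points of `A` along the segments `ζ - t • M ζ`, then it is bounded
by the extremal function of continuous candidates. -/
theorem le_omegaC_of_limsup_le (hD : IsOpen D) (hDc : IsCompact (closure D)) (hA : IsCompact A)
    (hAD : A ⊆ closure D) {M : (Fin n → ℂ) →L[ℂ] (Fin n → ℂ)}
    (hM : ∀ᶠ t : ℝ in 𝓝[>] 0, ∀ x ∈ closure D, x - (t : ℂ) • M x ∈ D)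
    {u : (Fin n → ℂ) → EReal} (hu : u ∈ PSHNeg D)
    (hlim : ∀ ζ ∈ A, limsup (fun t : ℝ => u (ζ - (t : ℂ) • M ζ)) (𝓝[>] 0) ≤ -1)
    {z : Fin n → ℂ} (hz : z ∈ D) : u z ≤ omegaC D A z := by
  set v := truncation u with hv
  have husc := upperSemicontinuousOn_truncation hu
  have h0 : ∀ x ∈ D, v x ≤ 0 := fun x hx => truncation_nonpos (hu.2 x hx)
  have h1 : ∀ x ∈ D, -1 ≤ v x := fun x hx => neg_one_le_truncation (hu.2 x hx)
  have hm := subMeanOn_truncation hu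
  have hlimv : ∀ ζ ∈ A, Tendsto (fun t : ℝ => v (ζ - (t : ℂ) • M ζ)) (𝓝[>] 0) (𝓝 (-1)) := by
    intro ζ hζ
    rw [tendsto_order]
    constructor
    · intro c hc
      filter_upwards [hM] with t ht
      exact hc.trans_le (h1 _ (ht ζ (hAD hζ)))
    · intro c hc
      have hlt : limsup (fun t : ℝ => u (ζ - (t : ℂ) • M ζ)) (𝓝[>] 0) < (c : EReal) :=
        (hlim ζ hζ).trans_lt (coe_neg_one ▸ EReal.coe_lt_coe_iff.2 hc)
      filter_upwards [hM, eventually_lt_of_limsup_lt hlt] with t ht htc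
      exact truncation_lt (hu.2 _ (ht ζ (hAD hζ))) hc htc
  -- A candidate below `-1 + ε` on `A` becomes admissible after division by `1 - ε`.
  have key : ∀ ε : ℝ, 0 < ε → ε < 1 → (((v z - ε) / (1 - ε) : ℝ) : EReal) ≤ omegaC D A z := by
    intro ε hε hε1
    -- The times `t k → 0` are selected so that `v (T k z) > v z - ε`; convergence on `A` holds
    -- along any such sequence.
    have hfreq := (frequently_lt_along_segment hD husc h0 h1 hm hz (M z)
      (show v z - ε < v z by linarith)).and_eventually hM
    obtain ⟨t, ht, htk⟩ := exists_seq_forall_of_frequently hfreq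
    obtain ⟨T, hT⟩ : ∃ T : ℕ → (Fin n → ℂ) →L[ℂ] (Fin n → ℂ),
        ∀ k x, T k x = x - (t k : ℂ) • M x :=
      ⟨fun k => ContinuousLinearMap.id ℂ _ - (t k : ℂ) • M, fun k x => by
        rw [sub_apply, smul_apply,
          ContinuousLinearMap.id_apply]⟩
    obtain ⟨w, ⟨hw1, hw2, hw3, hw4⟩, hwA⟩ := exists_candidate_lt hD hDc hA hAD husc h0 h1 hm hz
      (T := T) (s := v z - ε) (fun k x hx => by rw [hT]; exact (htk k).2 x hx)
      (fun ζ hζ => by simp only [hT]; exact (hlimv ζ hζ).comp ht)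
      (fun k => by rw [hT]; exact (htk k).1.le) hε
    have hpos : 0 < 1 - ε := by linarith
    have hle : (((v z - ε) / (1 - ε) : ℝ) : EReal) ≤ (((1 - ε)⁻¹ * w z : ℝ) : EReal) := by
      rw [EReal.coe_le_coe_iff, div_eq_inv_mul]
      exact mul_le_mul_of_nonneg_left hw4 (by positivity)
    have hwc : ContinuousOn (fun x => (1 - ε)⁻¹ * w x) (closure D) := continuousOn_const.mul hw1
    have hmem : (fun x => (((1 - ε)⁻¹ * w x : ℝ) : EReal)) ∈ PSHNeg D := by
      refine coe_mem_PSHNeg (v := fun x => (1 - ε)⁻¹ * w x)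
        (hwc.mono subset_closure).upperSemicontinuousOn (fun x hx => ?_) ?_
      · exact mul_nonpos_of_nonneg_of_nonpos (by positivity) (hw2 x hx)
      · exact hw3.const_mul (by positivity)
    refine hle.trans (coe_le_omegaC hmem hwc (fun ζ hζ => ?_) z)
    rw [inv_mul_le_iff₀ hpos]
    linarith [hwA ζ hζ]
  have htend : Tendsto (fun ε : ℝ => (((v z - ε) / (1 - ε) : ℝ) : EReal)) (𝓝[>] 0)
      (𝓝 ((v z : ℝ) : EReal)) := by
    have hc : ContinuousAt (fun ε : ℝ => (v z - ε) / (1 - ε)) 0 :=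
      ContinuousAt.div (by fun_prop) (by fun_prop) (by norm_num)
    have := (continuous_coe_real_ereal.continuousAt.comp hc).tendsto
    simp only [Function.comp_def, sub_zero, div_one] at this
    exact this.mono_left nhdsWithin_le_nhds
  refine (le_coe_truncation (hu.2 z hz)).trans (le_of_tendsto htend ?_)
  filter_upwards [Ioo_mem_nhdsGT (zero_lt_one' ℝ)] with ε hε
  exact key ε hε.1 hε.2

/-! ### Geometry of the ellipsoid -/

section hermForm

variable {n : ℕ} {H : Matrix (Fin n) (Fin n) ℂ}

theorem continuous_hermForm (H : Matrix (Fin n) (Fin n) ℂ) : Continuous (hermForm H) := by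
  unfold hermForm
  have : Continuous fun z : Fin n → ℂ => H.mulVec z := continuous_const.matrix_mulVec continuous_id
  exact Complex.continuous_re.comp (continuous_star.dotProduct this)

theorem hermForm_add_smul (hH : H.IsHermitian) (x y : Fin n → ℂ) (t : ℝ) :
    hermForm H (x + (t : ℂ) • y) =
      hermForm H x + 2 * t * (star y ⬝ᵥ H.mulVec x).re + t ^ 2 * hermForm H y := by
  have hsymm : (star x ⬝ᵥ H.mulVec y).re = (star y ⬝ᵥ H.mulVec x).re := by
    have : star x ⬝ᵥ H.mulVec y = star (star y ⬝ᵥ H.mulVec x) := by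
      rw [← Matrix.star_dotProduct, Matrix.star_mulVec, hH.eq, Matrix.dotProduct_mulVec]
    rw [this, Complex.star_def, Complex.conj_re]
  unfold hermForm
  simp only [star_add, star_smul, Matrix.mulVec_add, Matrix.mulVec_smul, add_dotProduct,
    dotProduct_add, smul_dotProduct, dotProduct_smul, smul_eq_mul, Complex.add_re,
    Complex.star_def, Complex.conj_ofReal, Complex.re_ofReal_mul, hsymm]
  ring

theorem hermForm_sub_smul (hH : H.IsHermitian) (x y : Fin n → ℂ) (t : ℝ) :
    hermForm H (x - (t : ℂ) • y) =
      hermForm H x - 2 * t * (star y ⬝ᵥ H.mulVec x).re + t ^ 2 * hermForm H y := by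
  have := hermForm_add_smul hH x y (-t)
  push_cast at this
  rw [neg_smul, ← sub_eq_add_neg] at this
  rw [this]
  ring

theorem hermForm_ofReal_smul (H : Matrix (Fin n) (Fin n) ℂ) (t : ℝ) (x : Fin n → ℂ) :
    hermForm H ((t : ℂ) • x) = t ^ 2 * hermForm H x := by
  unfold hermForm
  simp only [star_smul, Matrix.mulVec_smul, smul_dotProduct, dotProduct_smul, smul_eq_mul,
    Complex.star_def, Complex.conj_ofReal, Complex.re_ofReal_mul]
  ring

theorem hermForm_zero (H : Matrix (Fin n) (Fin n) ℂ) : hermForm H 0 = 0 := by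
  simp [hermForm]

theorem hermForm_pos (hH : H.PosDef) {x : Fin n → ℂ} (hx : x ≠ 0) : 0 < hermForm H x :=
  (Complex.lt_def.1 (hH.dotProduct_mulVec_pos hx)).1

theorem hermForm_nonneg (hH : H.PosDef) (x : Fin n → ℂ) : 0 ≤ hermForm H x := by
  rcases eq_or_ne x 0 with rfl | hx
  · exact (hermForm_zero H).ge
  · exact (hermForm_pos hH hx).le

theorem exists_norm_sq_le_hermForm (hH : H.PosDef) :
    ∃ c : ℝ, 0 < c ∧ ∀ x, c * ‖x‖ ^ 2 ≤ hermForm H x := by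
  -- The sphere is empty when `n = 0`. Otherwise the minimum on it serves as `c`, by homogeneity.
  rcases (Metric.sphere (0 : Fin n → ℂ) 1).eq_empty_or_nonempty with he | hne
  · refine ⟨1, one_pos, fun x => ?_⟩
    have : x = 0 := by
      by_contra hx
      have : ((‖x‖⁻¹ : ℝ) : ℂ) • x ∈ Metric.sphere (0 : Fin n → ℂ) 1 := by
        simp [norm_smul, hx]
      rw [he] at this
      exact this
    rw [this, hermForm_zero]
    simp
  · obtain ⟨y, hy, hmin⟩ := (isCompact_sphere (0 : Fin n → ℂ) 1).exists_isMinOn hne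
      (continuous_hermForm H).continuousOn
    have hy0 : y ≠ 0 := by
      rintro rfl
      simp at hy
    refine ⟨hermForm H y, hermForm_pos hH hy0, fun x => ?_⟩
    rcases eq_or_ne x 0 with rfl | hx
    · simp [hermForm_zero]
    · have hmem : ((‖x‖⁻¹ : ℝ) : ℂ) • x ∈ Metric.sphere (0 : Fin n → ℂ) 1 := by
        simp [norm_smul, hx]
      have h1 : hermForm H y ≤ hermForm H (((‖x‖⁻¹ : ℝ) : ℂ) • x) := hmin hmem
      have hn : 0 < ‖x‖ ^ 2 := by positivity
      rwa [hermForm_ofReal_smul, inv_pow, inv_mul_eq_div, le_div_iff₀ hn] at h1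

theorem exists_hermForm_le_norm_sq (H : Matrix (Fin n) (Fin n) ℂ) :
    ∃ C : ℝ, 0 < C ∧ ∀ x, hermForm H x ≤ C * ‖x‖ ^ 2 := by
  obtain ⟨C, hC⟩ := (isCompact_sphere (0 : Fin n → ℂ) 1).bddAbove_image
    (continuous_hermForm H).continuousOn
  refine ⟨max C 1, by positivity, fun x => ?_⟩
  rcases eq_or_ne x 0 with rfl | hx
  · simp [hermForm_zero]
  · have hmem : ((‖x‖⁻¹ : ℝ) : ℂ) • x ∈ Metric.sphere (0 : Fin n → ℂ) 1 := by
      simp [norm_smul, hx]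
    have h1 := (hC (Set.mem_image_of_mem _ hmem)).trans (le_max_left C 1)
    have hn : 0 < ‖x‖ ^ 2 := by positivity
    rwa [hermForm_ofReal_smul, inv_pow, inv_mul_eq_div, div_le_iff₀ hn] at h1

theorem isOpen_ellipsoid (H : Matrix (Fin n) (Fin n) ℂ) : IsOpen (ellipsoid H) :=
  isOpen_lt (continuous_hermForm H) continuous_const

theorem hermForm_le_one_of_mem_closure {x : Fin n → ℂ} (hx : x ∈ closure (ellipsoid H)) :
    hermForm H x ≤ 1 :=
  closure_lt_subset_le (continuous_hermForm H) continuous_const hx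

theorem isCompact_closure_ellipsoid (hH : H.PosDef) : IsCompact (closure (ellipsoid H)) := by
  obtain ⟨c, hc, hcx⟩ := exists_norm_sq_le_hermForm hH
  refine (isCompact_closedBall (0 : Fin n → ℂ) √(1 / c)).of_isClosed_subset isClosed_closure
    fun x hx => ?_
  rw [mem_closedBall_zero_iff]
  refine Real.le_sqrt_of_sq_le ?_
  rw [le_div_iff₀ hc, mul_comm]
  exact (hcx x).trans (hermForm_le_one_of_mem_closure hx)

theorem sub_smul_self_mem_ellipsoid (hH : H.PosDef) {x : Fin n → ℂ}
    (hx : x ∈ closure (ellipsoid H)) {t : ℝ} (ht0 : 0 < t) (ht1 : t < 1) :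
    x - (t : ℂ) • x ∈ ellipsoid H := by
  have h1 := hermForm_le_one_of_mem_closure hx
  have h2 := hermForm_nonneg hH x
  have h3 : x - (t : ℂ) • x = ((1 - t : ℝ) : ℂ) • x := by push_cast; rw [sub_smul, one_smul]
  change hermForm H _ < 1
  rw [h3, hermForm_ofReal_smul]
  calc (1 - t) ^ 2 * hermForm H x ≤ (1 - t) ^ 2 * 1 := by gcongr
    _ < 1 := by nlinarith

theorem eventually_sub_smul_self_mem (hH : H.PosDef) :
    ∀ᶠ t : ℝ in 𝓝[>] 0, ∀ x ∈ closure (ellipsoid H), x - (t : ℂ) • x ∈ ellipsoid H := by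
  filter_upwards [Ioo_mem_nhdsGT (zero_lt_one' ℝ)] with t ht x hx
  exact sub_smul_self_mem_ellipsoid hH hx ht.1 ht.2

/-- With `y = H x`, the form at `x - t y` is `ρ(x) - 2t |y|² + t² ρ(y)`, where `|y|` is the
Euclidean norm. The linear term wins for `t < c / C`, uniformly in `x`, because both `ρ(y)` and
`|y|²` are comparable to `‖y‖ ^ 2`. -/
theorem eventually_sub_smul_mulVec_mem (hH : H.PosDef) :
    ∀ᶠ t : ℝ in 𝓝[>] 0, ∀ x ∈ closure (ellipsoid H), x - (t : ℂ) • H.mulVec x ∈ ellipsoid H := by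
  obtain ⟨c, hc, hcx⟩ := exists_norm_sq_le_hermForm (Matrix.PosDef.one (n := Fin n) (R := ℂ))
  obtain ⟨C, hC, hCx⟩ := exists_hermForm_le_norm_sq H
  filter_upwards [Ioo_mem_nhdsGT (show (0 : ℝ) < c / C by positivity)] with t ht x hx
  have h1 := hermForm_le_one_of_mem_closure hx
  change hermForm H _ < 1
  rw [hermForm_sub_smul hH.isHermitian]
  set y := H.mulVec x with hy
  have hN : (star y ⬝ᵥ y).re = hermForm 1 y := by simp [hermForm]
  rw [hN]
  rcases eq_or_ne y 0 with h0 | h0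
  · have hx0 : hermForm H x = 0 := by simp [hermForm, ← hy, h0]
    rw [h0, hermForm_zero, hermForm_zero, hx0]
    simp
  · have hn : 0 < ‖y‖ ^ 2 := by positivity
    have h2 : t * C < c := (lt_div_iff₀ hC).1 ht.2
    have h3 : t ^ 2 * hermForm H y ≤ t * (c * ‖y‖ ^ 2) := by
      calc t ^ 2 * hermForm H y ≤ t ^ 2 * (C * ‖y‖ ^ 2) := by gcongr; exact hCx y
        _ = t * (t * C * ‖y‖ ^ 2) := by ring
        _ ≤ _ := by
          have := ht.1.le
          gcongr
    have h4 : t * (c * ‖y‖ ^ 2) ≤ t * hermForm 1 y :=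
      mul_le_mul_of_nonneg_left (hcx y) ht.1.le
    have h5 : 0 < t * (c * ‖y‖ ^ 2) := mul_pos ht.1 (by positivity)
    linarith

theorem differentiable_hermForm (H : Matrix (Fin n) (Fin n) ℂ) :
    Differentiable ℝ (hermForm H) := by
  have h : hermForm H =
      fun z => Complex.reCLM (∑ i, Complex.conjCLE (z i) * ∑ j, H i j * z j) := by
    ext z
    simp [hermForm, dotProduct, Matrix.mulVec]
  rw [h]
  fun_prop

theorem fderiv_hermForm_sub_one (hH : H.IsHermitian) (x y : Fin n → ℂ) :
    fderiv ℝ (fun w => hermForm H w - 1) x y = 2 * (star y ⬝ᵥ H.mulVec x).re := by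
  rw [fderiv_sub_const, ← (differentiable_hermForm H x).lineDeriv_eq_fderiv]
  have h : (fun t : ℝ => hermForm H (x + t • y)) = fun t : ℝ =>
      hermForm H x + 2 * t * (star y ⬝ᵥ H.mulVec x).re + t ^ 2 * hermForm H y := by
    ext t
    rw [← hermForm_add_smul hH, Complex.coe_smul]
  rw [lineDeriv, h]
  have h1 : HasDerivAt (fun t : ℝ => hermForm H x + 2 * t * (star y ⬝ᵥ H.mulVec x).re
      + t ^ 2 * hermForm H y) (2 * 1 * (star y ⬝ᵥ H.mulVec x).re
      + ((2 : ℕ) * (0 : ℝ) ^ (2 - 1)) * hermForm H y) 0 :=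
    ((((hasDerivAt_id (0 : ℝ)).const_mul 2).mul_const _).const_add _).add
      ((hasDerivAt_pow 2 (0 : ℝ)).mul_const _)
  rw [h1.deriv]
  simp

/-- The derivatives in the directions `e_j` and `i e_j` are twice the real and imaginary parts of
`(H x)_j`. Thus the normal direction depends complex linearly on the base point, which is what makes
ellipsoids tractable here. -/
theorem dbarGrad_hermForm_sub_one (hH : H.IsHermitian) (x : Fin n → ℂ) :
    dbarGrad (fun w => hermForm H w - 1) x = H.mulVec x := by
  ext j
  have hs : ∀ c : ℂ, (star (Pi.single j c : Fin n → ℂ)) ⬝ᵥ H.mulVec x = star c * H.mulVec x j := by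
    intro c
    rw [← Pi.single_star, single_dotProduct]
  rw [dbarGrad, fderiv_hermForm_sub_one hH, fderiv_hermForm_sub_one hH, hs, hs]
  apply Complex.ext <;> simp

theorem normalPoint_hermForm_sub_one (hH : H.IsHermitian) (x : Fin n → ℂ) (t : ℝ) :
    normalPoint (fun w => hermForm H w - 1) x t = x - (t : ℂ) • H.mulVec x := by
  rw [normalPoint, dbarGrad_hermForm_sub_one hH]

end hermForm

/-! ### Comparison of the four extremal functions -/

section comparison

variable {n : ℕ} {H : Matrix (Fin n) (Fin n) ℂ} {D A : Set (Fin n → ℂ)}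

theorem omegaC_le_omega (hA : A ⊆ closure D) (z : Fin n → ℂ) : omegaC D A z ≤ omega D A z := by
  refine sSup_le ?_
  rintro _ ⟨u, hu, huc, huA, rfl⟩
  refine le_sSup ⟨_, hu, fun ζ hζ => ?_, rfl⟩
  have : (𝓝[D] ζ).NeBot := mem_closure_iff_nhdsWithin_neBot.1 (hA hζ)
  have ht : Tendsto (fun w => (u w : EReal)) (𝓝[D] ζ) (𝓝 (u ζ : EReal)) :=
    (continuous_coe_real_ereal.tendsto _).comp
      ((huc ζ (hA hζ)).mono_left (nhdsWithin_mono ζ subset_closure))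
  rw [upperLimit, ht.limsup_eq, ← coe_neg_one, EReal.coe_le_coe_iff]
  exact huA ζ hζ

theorem limsup_along_le_upperLimit {u : (Fin n → ℂ) → EReal} {ζ b : Fin n → ℂ}
    (hb : ∀ᶠ t : ℝ in 𝓝[>] 0, ζ - (t : ℂ) • b ∈ D) :
    limsup (fun t : ℝ => u (ζ - (t : ℂ) • b)) (𝓝[>] 0) ≤ upperLimit D u ζ := by
  have hc : Tendsto (fun t : ℝ => ζ - (t : ℂ) • b) (𝓝[>] 0) (𝓝 ζ) := by
    have : Continuous fun t : ℝ => ζ - (t : ℂ) • b := by fun_prop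
    simpa using (this.tendsto 0).mono_left (nhdsWithin_le_nhds (s := Set.Ioi 0))
  exact limsup_le_limsup_of_le (tendsto_nhdsWithin_iff.2 ⟨hc, hb⟩) (u := u)

theorem normalLimit_hermForm_sub_one (hH : H.IsHermitian) (u : (Fin n → ℂ) → EReal)
    (ζ : Fin n → ℂ) : normalLimit (fun w => hermForm H w - 1) u ζ =
      limsup (fun t : ℝ => u (ζ - (t : ℂ) • H.mulVec ζ)) (𝓝[>] 0) := by
  simp only [normalLimit, normalPoint_hermForm_sub_one hH]

theorem radialLimit_eq (u : (Fin n → ℂ) → EReal) (ζ : Fin n → ℂ) :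
    radialLimit u ζ = limsup (fun t : ℝ => u (ζ - (t : ℂ) • ζ)) (𝓝[>] 0) := by
  have h1 : (fun t : ℝ => u (ζ - (t : ℂ) • ζ)) = (fun r : ℝ => u ((r : ℂ) • ζ)) ∘ fun t => 1 - t := by
    ext t
    simp [sub_smul]
  have h2 : map (fun t : ℝ => 1 - t) (𝓝[>] 0) = 𝓝[<] 1 := by
    simp
  rw [radialLimit, h1, limsup_comp, h2]

theorem omega_le_omegaN (hH : H.PosDef) (hA : A ⊆ closure (ellipsoid H)) (z : Fin n → ℂ) :
    omega (ellipsoid H) A z ≤ omegaN (ellipsoid H) (fun w => hermForm H w - 1) A z := by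
  refine sSup_le_sSup ?_
  rintro _ ⟨u, hu, huA, rfl⟩
  refine ⟨u, hu, fun ζ hζ => ?_, rfl⟩
  rw [normalLimit_hermForm_sub_one hH.isHermitian]
  exact (limsup_along_le_upperLimit ((eventually_sub_smul_mulVec_mem hH).mono
    fun t ht => ht ζ (hA hζ))).trans (huA ζ hζ)

theorem omega_le_omegaR (hH : H.PosDef) (hA : A ⊆ closure (ellipsoid H)) (z : Fin n → ℂ) :
    omega (ellipsoid H) A z ≤ omegaR (ellipsoid H) A z := by
  refine sSup_le_sSup ?_
  rintro _ ⟨u, hu, huA, rfl⟩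
  refine ⟨u, hu, fun ζ hζ => ?_, rfl⟩
  rw [radialLimit_eq]
  exact (limsup_along_le_upperLimit ((eventually_sub_smul_self_mem hH).mono
    fun t ht => ht ζ (hA hζ))).trans (huA ζ hζ)

theorem omegaN_le_omegaC (hH : H.PosDef) (hAc : IsCompact A) (hA : A ⊆ closure (ellipsoid H))
    {z : Fin n → ℂ} (hz : z ∈ ellipsoid H) :
    omegaN (ellipsoid H) (fun w => hermForm H w - 1) A z ≤ omegaC (ellipsoid H) A z := by
  refine sSup_le ?_
  rintro _ ⟨u, hu, huA, rfl⟩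
  refine le_omegaC_of_limsup_le (M := LinearMap.toContinuousLinearMap (Matrix.mulVecLin H))
    (isOpen_ellipsoid H) (isCompact_closure_ellipsoid hH) hAc hA
    (eventually_sub_smul_mulVec_mem hH) hu (fun ζ hζ => ?_) hz
  have := huA ζ hζ
  rwa [normalLimit_hermForm_sub_one hH.isHermitian] at this

theorem omegaR_le_omegaC (hH : H.PosDef) (hAc : IsCompact A) (hA : A ⊆ closure (ellipsoid H))
    {z : Fin n → ℂ} (hz : z ∈ ellipsoid H) :
    omegaR (ellipsoid H) A z ≤ omegaC (ellipsoid H) A z := by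
  refine sSup_le ?_
  rintro _ ⟨u, hu, huA, rfl⟩
  refine le_omegaC_of_limsup_le (M := ContinuousLinearMap.id ℂ _)
    (isOpen_ellipsoid H) (isCompact_closure_ellipsoid hH) hAc hA
    (eventually_sub_smul_self_mem hH) hu (fun ζ hζ => ?_) hz
  have := huA ζ hζ
  rwa [radialLimit_eq] at this

end comparison

end BoundaryExtremal

theorem mainTheorem1 (n : ℕ) (H : Matrix (Fin n) (Fin n) ℂ) (hH : H.PosDef)
    (A : Set (Fin n → ℂ)) (hA : IsCompact A)
    (hAD : A ⊆ frontier (BoundaryExtremal.ellipsoid H))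
    (z : Fin n → ℂ) (hz : z ∈ BoundaryExtremal.ellipsoid H) :
    BoundaryExtremal.omega (BoundaryExtremal.ellipsoid H) A z =
        BoundaryExtremal.omegaN (BoundaryExtremal.ellipsoid H)
          (fun w => BoundaryExtremal.hermForm H w - 1) A z ∧
      BoundaryExtremal.omegaN (BoundaryExtremal.ellipsoid H)
          (fun w => BoundaryExtremal.hermForm H w - 1) A z =
        BoundaryExtremal.omegaR (BoundaryExtremal.ellipsoid H) A z ∧
      BoundaryExtremal.omegaR (BoundaryExtremal.ellipsoid H) A z =
        BoundaryExtremal.omegaC (BoundaryExtremal.ellipsoid H) A z := by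
  have hAc := hAD.trans frontier_subset_closure
  have h1 := BoundaryExtremal.omegaC_le_omega hAc z
  have h2 := BoundaryExtremal.omega_le_omegaN hH hAc z
  have h3 := BoundaryExtremal.omega_le_omegaR hH hAc z
  have h4 := BoundaryExtremal.omegaN_le_omegaC hH hA hAc hz
  have h5 := BoundaryExtremal.omegaR_le_omegaC hH hA hAc hz
  exact ⟨h2.antisymm (h4.trans h1), (h4.trans (h1.trans h3)).antisymm (h5.trans (h1.trans h2)),
    h5.antisymm (h1.trans h3)⟩
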